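/- Let $\mathbb D=\{w\in\mathbb C:|w|<1\}$, $\mathbb E=\{w\in\mathbb C:|w|>1\}$ and $\mathbb T=\{w\in\mathbb C:|w|=1\}$. For $p\in\mathbb C[z_1,\dots,z_n]$ let $Z_p\subseteq\mathbb C^n$ be its zero set, and let $\mathrm{Hol}(Z_p)$ be the algebra of all functions $f:Z_p\to\mathbb C$ such that every point of $Z_p$ has an open neighbourhood $U$ in $\mathbb C^n$ and a holomorphic function $g$ on $U$ with $g|_{U\cap Z_p}=f|_{U\cap Z_p}$. The polynomial $p$ is called toral if $\mathbb T^n$ is determining for $Z_p$, that is, if every $f\in\mathrm{Hol}(Z_p)$ that vanishes on $Z_p\cap\mathbb T^n$ vanishes identically on $Z_p$. Theorem. Let $p\in\mathbb C[z_1,\dots,z_n]$, and suppose that $Z_p$ is disjoint from $\mathbb D^n\cup\mathbb E^n$. Then $p$ is toral. -/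

import Mathlib

namespace ToralSets

/-- The zero set `Z_p` in `ℂⁿ` of a polynomial `p ∈ ℂ[z₁, …, zₙ]`. -/
def zeroSet {n : ℕ} (p : MvPolynomial (Fin n) ℂ) : Set (Fin n → ℂ) :=
  {z | MvPolynomial.eval z p = 0}

/-- The open unit polydisk `𝔻ⁿ`. -/
def polydisk (n : ℕ) : Set (Fin n → ℂ) := {z | ∀ i, ‖z i‖ < 1}

/-- The exterior polydisk `𝔼ⁿ`, where `𝔼` is the complement in `ℂ` of the closed unit disk. -/
def exteriorPolydisk (n : ℕ) : Set (Fin n → ℂ) := {z | ∀ i, 1 < ‖z i‖}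

/-- The torus `𝕋ⁿ`. -/
def torus (n : ℕ) : Set (Fin n → ℂ) := {z | ∀ i, ‖z i‖ = 1}

/-- `Hol(A)`: the complex-valued functions on `A` that coincide, near every point of `A`, with the
restriction to `A` of a holomorphic function on an open subset of `ℂⁿ`. -/
def Hol {n : ℕ} (A : Set (Fin n → ℂ)) : Set (A → ℂ) :=
  {f | ∀ a : A, ∃ U : Set (Fin n → ℂ), IsOpen U ∧ (a : Fin n → ℂ) ∈ U ∧
    ∃ g : (Fin n → ℂ) → ℂ, DifferentiableOn ℂ g U ∧
      ∀ z : A, (z : Fin n → ℂ) ∈ U → g z = f z}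

/-- `X` is determining for `A`: every `f ∈ Hol(A)` that vanishes on `X ∩ A` vanishes on all of `A`.
The set `X` need not be contained in `A`. -/
def IsDetermining {n : ℕ} (X A : Set (Fin n → ℂ)) : Prop :=
  ∀ f ∈ Hol A, (∀ z : A, (z : Fin n → ℂ) ∈ X → f z = 0) → ∀ z : A, f z = 0

/-- An (algebraic) set `A` in `ℂⁿ` is toral if `𝕋ⁿ` is determining for it. -/
def IsToralSet {n : ℕ} (A : Set (Fin n → ℂ)) : Prop :=
  IsDetermining (torus n) A

/-- A polynomial is toral if its zero set is. -/
def IsToral {n : ℕ} (p : MvPolynomial (Fin n) ℂ) : Prop :=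
  IsToralSet (zeroSet p)

end ToralSets

/-!
Let `f ∈ Hol(Z_p)` vanish on `Z_p ∩ 𝕋ⁿ`. The hypothesis says that `p(0) ≠ 0` and that for `τ ∈ 𝕋ⁿ`
all roots of the polynomial `ζ ↦ p(ζτ)` are unimodular, so that each root gives a point
`ζτ ∈ Z_p ∩ 𝕋ⁿ`, where `f` vanishes.

A zero `w` of `p` without zero coordinates lies on an entire curve `γ : ℂ → ℂⁿ` with `γ(1) = w`
that maps the imaginary axis into `𝕋ⁿ`, namely `γ(s)ᵢ = (wᵢ / |wᵢ|) exp (s log |wᵢ|)`. The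
polynomials `Q_s(ζ) = p(ζ γ(s))` depend holomorphically on `s`. Their generic leading coefficient
has constant modulus on the imaginary axis, because the constant coefficient is `p(0)` and the roots
are unimodular; by reflection in the axis it has no zeros, and the degree of `Q_s` is constant
(`exists_natDegree_eq`). Hence traces over the roots of `Q_s` are entire in `s`
(`differentiableAt_sum_roots`), and so is the trace of `f(ζ γ(s)) L(ζ)` for any polynomial `L`. It
vanishes on the imaginary axis, hence at `s = 1`. If `L` vanishes at all roots of `Q_1` but the root
`1`, which corresponds to `w`, this says that `f(w) = 0` (`eq_zero_of_forall_ne_zero`). Every other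
zero of `p` is a limit of such points `w` (`mem_closure_zeroSet_ne_zero`), and `f` is continuous.
-/

namespace ToralSets

open Metric Set Filter Topology MeasureTheory Polynomial

/-! ### Circle integrals -/

/-- A circle integral depends holomorphically on a parameter in which the integrand is
holomorphic. Cauchy's estimate bounds the derivative of the integrand, so no continuity of that
derivative in the two variables jointly is needed. -/
theorem differentiableAt_circleIntegral {H : ℂ → ℂ → ℂ} {s₀ c : ℂ} {r δ : ℝ}
    (hr : 0 ≤ r) (hδ : 0 < δ)
    (hH : ∀ s ∈ ball s₀ δ, ∀ ζ ∈ sphere c r,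
      DifferentiableAt ℂ (fun x : ℂ × ℂ => H x.1 x.2) (s, ζ)) :
    DifferentiableAt ℂ (fun s => ∮ ζ in C(c, r), H s ζ) s₀ := by
  classical
  have hs : ∀ s ∈ ball s₀ δ, ∀ ζ ∈ sphere c r, DifferentiableAt ℂ (fun s => H s ζ) s :=
    fun s hs ζ hζ => (hH s hs ζ hζ).comp (f := fun s => (s, ζ)) s (by fun_prop)
  have hsub : closedBall s₀ (δ / 2) ⊆ ball s₀ δ := closedBall_subset_ball (by linarith)
  have hsub' : ball s₀ (δ / 4) ⊆ ball s₀ δ := ball_subset_ball (by linarith)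
  have hmem : ∀ θ, circleMap c r θ ∈ sphere c r := circleMap_mem_sphere c hr
  obtain ⟨M, hM⟩ := ((isCompact_closedBall s₀ (δ / 2)).prod
    (isCompact_sphere c r)).exists_bound_of_continuousOn (f := fun x : ℂ × ℂ => H x.1 x.2)
      fun x hx => (hH x.1 (hsub hx.1) x.2 hx.2).continuousAt.continuousWithinAt
  have hcont : ∀ s ∈ ball s₀ δ,
      Continuous fun θ => deriv (circleMap c r) θ • H s (circleMap c r θ) := by
    intro s hs
    have hc : Continuous fun θ => deriv (circleMap c r) θ := by
      simp only [deriv_circleMap]; fun_prop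
    exact hc.smul (continuous_iff_continuousAt.2 fun θ =>
      ContinuousAt.comp (g := fun x : ℂ × ℂ => H x.1 x.2) (f := fun θ => (s, circleMap c r θ))
        (hH s hs _ (hmem θ)).continuousAt (by fun_prop))
  have hderiv : ∀ θ, ∀ s ∈ ball s₀ (δ / 4),
      HasDerivAt (fun s => deriv (circleMap c r) θ • H s (circleMap c r θ))
        (deriv (circleMap c r) θ • deriv (fun s => H s (circleMap c r θ)) s) s :=
    fun θ s h => ((hs s (hsub' h) _ (hmem θ)).hasDerivAt).fun_const_smul _
  refine (intervalIntegral.hasDerivAt_integral_of_dominated_loc_of_deriv_le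
    (F := fun s θ => deriv (circleMap c r) θ • H s (circleMap c r θ))
    (F' := fun s θ => deriv (circleMap c r) θ • deriv (fun s => H s (circleMap c r θ)) s)
    (s := ball s₀ (δ / 4)) (bound := fun _ => r * (M / (δ / 4)))
    (ball_mem_nhds _ (by linarith)) ?_ ?_ ?_ ?_ ?_ ?_).2.differentiableAt
  · filter_upwards [ball_mem_nhds s₀ hδ] with s hs
    exact (hcont s hs).aestronglyMeasurable
  · exact (hcont s₀ (mem_ball_self hδ)).intervalIntegrable _ _
  · -- The derivative is a pointwise limit of continuous difference quotients.
    have h0 : s₀ ∈ ball s₀ (δ / 4) := mem_ball_self (by linarith)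
    have hlim : ∀ θ, Tendsto (fun s => if s ∈ ball s₀ δ then
        slope (fun s => deriv (circleMap c r) θ • H s (circleMap c r θ)) s₀ s else 0)
        (𝓝[≠] s₀) (𝓝 (deriv (circleMap c r) θ • deriv (fun s => H s (circleMap c r θ)) s₀)) := by
      intro θ
      refine (hderiv θ s₀ h0).tendsto_slope.congr' ?_
      filter_upwards [mem_nhdsWithin_of_mem_nhds (ball_mem_nhds s₀ hδ)] with s hs
      rw [if_pos hs]
    refine aestronglyMeasurable_of_tendsto_ae (𝓝[≠] s₀) (fun s => ?_)
      (Eventually.of_forall hlim)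
    by_cases h : s ∈ ball s₀ δ
    · simp only [h, if_true, slope, vsub_eq_sub]
      exact (((hcont s h).sub (hcont s₀ (mem_ball_self hδ))).const_smul
        (s - s₀)⁻¹).aestronglyMeasurable
    · simp only [h, if_false]
      exact aestronglyMeasurable_const
  · refine Eventually.of_forall fun θ _ s h => ?_
    rw [norm_smul, deriv_circleMap]
    have hn : ‖circleMap 0 r θ * Complex.I‖ = r := by simp [abs_of_nonneg hr]
    rw [hn]
    refine mul_le_mul_of_nonneg_left ?_ hr
    have hcb : closedBall s (δ / 4) ⊆ closedBall s₀ (δ / 2) :=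
      closedBall_subset_closedBall' (by linarith [mem_ball.1 h])
    refine Complex.norm_deriv_le_of_forall_mem_sphere_norm_le (by linarith) ?_ fun z hz =>
      hM (z, circleMap c r θ) ⟨hcb (sphere_subset_closedBall hz), hmem θ⟩
    refine DifferentiableOn.diffContOnCl fun z hz => ?_
    exact (hs z (hsub (hcb (closure_ball_subset_closedBall hz))) _ (hmem θ)).differentiableWithinAt
  · exact intervalIntegrable_const
  · exact Eventually.of_forall fun θ _ s h => hderiv θ s h

/-- The residue theorem for `g` times a logarithmic derivative: if `R` is the multiset of roots of
a polynomial `q`, then the sum in the integrand is `q' / q`. -/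
theorem circleIntegral_mul_sum_inv {c : ℂ} {r : ℝ} (hr : 0 ≤ r) {g : ℂ → ℂ}
    (hg : ∀ z ∈ closedBall c r, DifferentiableAt ℂ g z) (R : Multiset ℂ)
    (hR : ∀ a ∈ R, a ∉ sphere c r) :
    (∮ ζ in C(c, r), g ζ * (R.map fun a => 1 / (ζ - a)).sum) =
      2 * Real.pi * Complex.I *
        (R.map fun a => (ball c r).indicator g a).sum := by
  have hgc : ContinuousOn g (sphere c r) := fun z hz =>
    (hg z (sphere_subset_closedBall hz)).continuousAt.continuousWithinAt
  have hcont : ∀ a ∉ sphere c r, ContinuousOn (fun ζ => g ζ * (1 / (ζ - a))) (sphere c r) :=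
    fun a ha => hgc.mul (continuousOn_const.div (by fun_prop) fun z hz h =>
      ha (by rwa [← sub_eq_zero.1 h]))
  have hsum : ∀ R : Multiset ℂ, (∀ a ∈ R, a ∉ sphere c r) →
      ContinuousOn (fun ζ => g ζ * (R.map fun a => 1 / (ζ - a)).sum) (sphere c r) := by
    intro R
    induction R using Multiset.induction with
    | empty => intro _; simpa using continuousOn_const
    | cons a R ih =>
      intro h
      simp only [Multiset.map_cons, Multiset.sum_cons, mul_add]
      exact (hcont a (h a (Multiset.mem_cons_self a R))).add
        (ih fun b hb => h b (Multiset.mem_cons_of_mem hb))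
  have hone : ∀ a ∉ sphere c r, (∮ ζ in C(c, r), g ζ * (1 / (ζ - a))) =
      2 * Real.pi * Complex.I * (ball c r).indicator g a := by
    intro a ha
    by_cases hab : a ∈ ball c r
    · rw [indicator_of_mem hab]
      have := DifferentiableOn.circleIntegral_sub_inv_smul (f := g) (R := r) (c := c) (w := a)
        (fun z hz => (hg z hz).differentiableWithinAt) hab
      rw [smul_eq_mul] at this
      rw [← this]
      refine circleIntegral.integral_congr hr fun z _ => ?_
      simp [mul_comm]
    · rw [indicator_of_notMem hab, mul_zero]
      have hne : ∀ z ∈ closedBall c r, z - a ≠ 0 := fun z hz h => by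
        rw [sub_eq_zero.1 h, ← ball_union_sphere] at hz
        exact hz.elim hab ha
      have hd : ∀ z ∈ closedBall c r, DifferentiableAt ℂ (fun ζ => g ζ * (1 / (ζ - a))) z :=
        fun z hz => (hg z hz).mul ((differentiableAt_const _).div (by fun_prop) (hne z hz))
      exact Complex.circleIntegral_eq_zero_of_differentiable_on_off_countable hr
        countable_empty (fun z hz => (hd z hz).continuousAt.continuousWithinAt)
        fun z hz => hd z (ball_subset_closedBall hz.1)
  induction R using Multiset.induction with
  | empty => simp [circleIntegral]
  | cons a R ih =>
    have ha := hR a (Multiset.mem_cons_self a R)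
    have hR' : ∀ b ∈ R, b ∉ sphere c r := fun b hb => hR b (Multiset.mem_cons_of_mem hb)
    simp only [Multiset.map_cons, Multiset.sum_cons, mul_add]
    rw [circleIntegral.integral_add ((hcont a ha).circleIntegrable hr)
      ((hsum R hR').circleIntegrable hr), ih hR', hone a ha]

/-! ### Traces over the roots of a holomorphic family of polynomials -/

theorem differentiable_eval_family {Q : ℂ → ℂ[X]} {d : ℕ}
    (hcoeff : ∀ k, Differentiable ℂ fun s => (Q s).coeff k) (hdeg : ∀ s, (Q s).natDegree ≤ d) :
    Differentiable ℂ fun x : ℂ × ℂ => (Q x.1).eval x.2 := by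
  have h : (fun x : ℂ × ℂ => (Q x.1).eval x.2) =
      fun x => ∑ k ∈ Finset.range (d + 1), (Q x.1).coeff k * x.2 ^ k :=
    funext fun x => eval_eq_sum_range' (Nat.lt_succ_of_le (hdeg x.1)) x.2
  rw [h]
  refine Differentiable.fun_sum fun k _ => ?_
  exact ((hcoeff k).comp differentiable_fst).mul (differentiable_snd.pow k)

theorem differentiable_eval_derivative_family {Q : ℂ → ℂ[X]} {d : ℕ}
    (hcoeff : ∀ k, Differentiable ℂ fun s => (Q s).coeff k) (hdeg : ∀ s, (Q s).natDegree ≤ d) :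
    Differentiable ℂ fun x : ℂ × ℂ => (derivative (Q x.1)).eval x.2 := by
  refine differentiable_eval_family (Q := fun s => derivative (Q s)) (d := d) (fun k => ?_)
    fun s => (natDegree_derivative_le _).trans ((Nat.sub_le _ _).trans (hdeg s))
  simp only [coeff_derivative]
  exact (hcoeff (k + 1)).mul_const _

theorem continuousAt_cauchyBound {Q : ℂ → ℂ[X]} {d : ℕ} {s₀ : ℂ}
    (hcoeff : ∀ k, ContinuousAt (fun s => (Q s).coeff k) s₀)
    (hdeg : ∀ s, (Q s).natDegree = d) (hne : Q s₀ ≠ 0) :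
    ContinuousAt (fun s => cauchyBound (Q s)) s₀ := by
  simp only [cauchyBound, leadingCoeff, hdeg]
  refine (ContinuousAt.div ?_ (hcoeff d).nnnorm ?_).add continuousAt_const
  · exact ContinuousAt.finset_sup_apply fun k _ => (hcoeff k).nnnorm
  · rw [← hdeg s₀]; simpa using hne

/-- The trace of a function over the roots of a holomorphic family of polynomials is holomorphic.
The function `G` only matters at pairs `(s, ζ)` with `ζ` a root of `Q s`, and near each of these it
has to have a local holomorphic extension `g`, which may depend on the pair. Constancy of the degree
keeps roots from escaping to infinity. Locally the trace is a sum of contour integrals of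
`g * (Q s)' / Q s` over fixed small circles about the roots of `Q s₀`. -/
theorem differentiableAt_sum_roots {Q : ℂ → ℂ[X]} {d : ℕ}
    (hcoeff : ∀ k, Differentiable ℂ fun s => (Q s).coeff k)
    (hdeg : ∀ s, (Q s).natDegree = d) (hne : ∀ s, Q s ≠ 0) {G : ℂ → ℂ → ℂ} {s₀ : ℂ}
    (hG : ∀ ζ, (Q s₀).eval ζ = 0 → ∃ g : ℂ × ℂ → ℂ, ∀ᶠ x in 𝓝 (s₀, ζ),
      DifferentiableAt ℂ g x ∧ ((Q x.1).eval x.2 = 0 → g x = G x.1 x.2)) :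
    DifferentiableAt ℂ (fun s => ((Q s).roots.map (G s)).sum) s₀ := by
  have hQ := differentiable_eval_family hcoeff fun s => (hdeg s).le
  have hQ' := differentiable_eval_derivative_family hcoeff fun s => (hdeg s).le
  set T : Finset ℂ := (Q s₀).roots.toFinset with hT
  have hmemT : ∀ ζ, ζ ∈ T ↔ (Q s₀).eval ζ = 0 := fun ζ => by simp [hT, hne s₀]
  have hG' : ∀ ζ, ∃ g : ℂ × ℂ → ℂ, ζ ∈ T → ∀ᶠ x in 𝓝 (s₀, ζ),
      DifferentiableAt ℂ g x ∧ ((Q x.1).eval x.2 = 0 → g x = G x.1 x.2) := by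
    intro ζ
    by_cases h : ζ ∈ T
    · exact (hG ζ ((hmemT ζ).1 h)).imp fun g hg _ => hg
    · exact ⟨0, fun h' => absurd h' h⟩
  choose g hg using hG'
  -- A common radius for which the discs about the roots are disjoint and carry the extensions.
  obtain ⟨r, hr, hgood, hsep⟩ : ∃ r > 0, (∀ ζ ∈ T, ∀ x ∈ ball s₀ r ×ˢ closedBall ζ r,
      DifferentiableAt ℂ (g ζ) x ∧ ((Q x.1).eval x.2 = 0 → g ζ x = G x.1 x.2)) ∧
      ∀ ζ ∈ T, ∀ ξ ∈ T, ζ ≠ ξ → 2 * r < dist ζ ξ := by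
    have h1 : ∀ᶠ r in 𝓝[>] (0 : ℝ), ∀ ζ ∈ T, ∀ x ∈ ball s₀ r ×ˢ closedBall ζ r,
        DifferentiableAt ℂ (g ζ) x ∧ ((Q x.1).eval x.2 = 0 → g ζ x = G x.1 x.2) := by
      rw [Filter.eventually_all_finset]
      intro ζ hζ
      obtain ⟨ε, hε, h⟩ := Metric.eventually_nhds_iff_ball.1 (hg ζ hζ)
      filter_upwards [Ioo_mem_nhdsGT hε] with r hr x hx
      refine h x ?_
      rw [← ball_prod_same]
      exact ⟨ball_subset_ball hr.2.le hx.1, closedBall_subset_ball hr.2 hx.2⟩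
    have h2 : ∀ᶠ r in 𝓝[>] (0 : ℝ), ∀ ζ ∈ T, ∀ ξ ∈ T, ζ ≠ ξ → 2 * r < dist ζ ξ := by
      simp only [Filter.eventually_all_finset, Filter.eventually_imp_distrib_left]
      intro ζ _ ξ _ hne
      filter_upwards [Ioo_mem_nhdsGT (half_pos (dist_pos.2 hne))] with r hr
      linarith [hr.2]
    obtain ⟨r, ⟨h1, h2⟩, h3⟩ := ((h1.and h2).and self_mem_nhdsWithin).exists
    exact ⟨r, h3, h1, h2⟩
  -- Away from the discs, inside a large disc that contains all roots, `Q s` does not vanish.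
  set B : ℝ := cauchyBound (Q s₀) + 1 + r with hB
  set K : Set ℂ := closedBall 0 B \ ⋃ ζ ∈ T, ball ζ r with hK
  have hKc : IsCompact K :=
    (isCompact_closedBall 0 B).diff (isOpen_biUnion fun _ _ => isOpen_ball)
  have hKne : ∀ᶠ s in 𝓝 s₀, ∀ z ∈ K, (Q s).eval z ≠ 0 := by
    refine hKc.eventually_forall_of_forall_eventually fun z hz => ?_
    refine hQ.continuous.continuousAt.eventually_ne fun h0 => hz.2 ?_
    exact mem_biUnion ((hmemT z).2 h0) (mem_ball_self hr)
  have hbd : ∀ᶠ s in 𝓝 s₀, cauchyBound (Q s) < cauchyBound (Q s₀) + 1 :=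
    (continuousAt_cauchyBound (fun k => (hcoeff k).continuous.continuousAt) hdeg
      (hne s₀)).eventually_lt_const (lt_add_one _)
  obtain ⟨δ, hδ, hball⟩ := Metric.eventually_nhds_iff_ball.1
    ((hKne.and hbd).and (ball_mem_nhds s₀ hr))
  have hsphere : ∀ ζ ∈ T, sphere ζ r ⊆ K := by
    intro ζ hζ z hz
    refine ⟨?_, ?_⟩
    · have hlt := IsRoot.norm_lt_cauchyBound (hne s₀) ((hmemT ζ).1 hζ)
      have hlt' : ‖ζ‖ < (cauchyBound (Q s₀) : ℝ) := by exact_mod_cast hlt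
      rw [mem_closedBall_zero_iff]
      have h3 : ‖z - ζ‖ = r := by rw [← dist_eq_norm]; exact hz
      have := norm_le_norm_add_norm_sub' z ζ
      linarith
    · simp only [mem_iUnion, not_exists]
      intro ξ hξ hzξ
      by_cases h : ζ = ξ
      · subst h; rw [mem_ball, mem_sphere.1 hz] at hzξ; exact lt_irrefl _ hzξ
      · have := hsep ζ hζ ξ hξ h
        have h2 := dist_triangle_left ζ ξ z
        rw [mem_sphere.1 hz] at h2
        linarith [mem_ball.1 hzξ]
  have hroots : ∀ s ∈ ball s₀ δ, ∀ a ∈ (Q s).roots, ∃ ζ ∈ T, a ∈ ball ζ r := by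
    intro s hs a ha
    obtain ⟨⟨h1, h2⟩, -⟩ := hball s hs
    have ha' : (Q s).IsRoot a := isRoot_of_mem_roots ha
    by_contra hcon
    refine h1 a ⟨?_, by simpa using hcon⟩ ha'
    have h3 := (IsRoot.norm_lt_cauchyBound (hne s) ha').trans h2
    have h4 : ‖a‖ < (cauchyBound (Q s₀) : ℝ) + 1 := by exact_mod_cast h3
    rw [mem_closedBall_zero_iff]
    linarith
  have hformula : ∀ s ∈ ball s₀ δ, ((Q s).roots.map (G s)).sum =
      (2 * Real.pi * Complex.I)⁻¹ * ∑ ζ ∈ T, ∮ z in C(ζ, r),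
        g ζ (s, z) * ((derivative (Q s)).eval z / (Q s).eval z) := by
    intro s hs
    obtain ⟨⟨h1, -⟩, h2⟩ := hball s hs
    have hint : ∀ ζ ∈ T, (∮ z in C(ζ, r),
        g ζ (s, z) * ((derivative (Q s)).eval z / (Q s).eval z)) = 2 * Real.pi * Complex.I *
          ((Q s).roots.map fun a => (ball ζ r).indicator (fun z => g ζ (s, z)) a).sum := by
      intro ζ hζ
      rw [← circleIntegral_mul_sum_inv hr.le (g := fun z => g ζ (s, z)) (fun z hz => ?_)
        (Q s).roots fun a ha ha' => h1 a (hsphere ζ hζ ha') (isRoot_of_mem_roots ha)]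
      · refine circleIntegral.integral_congr hr.le fun z hz => ?_
        rw [(IsAlgClosed.splits (Q s)).eval_derivative_div_eval_of_ne_zero
          (h1 z (hsphere ζ hζ hz))]
      · exact (hgood ζ hζ (s, z) ⟨h2, hz⟩).1.comp (f := fun z => (s, z)) z (by fun_prop)
    rw [Finset.sum_congr rfl hint, ← Finset.mul_sum, inv_mul_cancel_left₀
      Complex.two_pi_I_ne_zero]
    refine Eq.trans ?_ (Multiset.sum_map_sum_map (Q s).roots T.val)
    refine congrArg Multiset.sum (Multiset.map_congr rfl fun a ha => ?_)
    obtain ⟨ζ, hζ, haζ⟩ := hroots s hs a ha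
    -- Each root lies in exactly one of the discs.
    change _ = ∑ ξ ∈ T, (ball ξ r).indicator (fun z => g ξ (s, z)) a
    rw [Finset.sum_eq_single_of_mem ζ hζ, indicator_of_mem haζ]
    · exact ((hgood ζ hζ (s, a) ⟨h2, ball_subset_closedBall haζ⟩).2
        (isRoot_of_mem_roots ha)).symm
    · intro ξ hξ hne
      refine indicator_of_notMem (fun haξ => ?_) _
      have := hsep ξ hξ ζ hζ hne
      have h3 := dist_triangle_left ξ ζ a
      linarith [mem_ball.1 haξ, mem_ball.1 haζ]
  refine DifferentiableAt.congr_of_eventuallyEq ?_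
    (eventually_of_mem (ball_mem_nhds s₀ hδ) hformula)
  refine (DifferentiableAt.fun_sum fun ζ hζ => ?_).const_mul _
  refine differentiableAt_circleIntegral
    (H := fun s z => g ζ (s, z) * ((derivative (Q s)).eval z / (Q s).eval z)) hr.le hδ ?_
  intro s hs z hz
  obtain ⟨⟨h1, -⟩, h2⟩ := hball s hs
  have hquot : DifferentiableAt ℂ
      (fun x : ℂ × ℂ => (derivative (Q x.1)).eval x.2 / (Q x.1).eval x.2) (s, z) := by
    simp only [div_eq_mul_inv]
    exact (hQ' (s, z)).mul ((hQ (s, z)).fun_inv (h1 z (hsphere ζ hζ hz)))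
  exact (hgood ζ hζ (s, z) ⟨h2, sphere_subset_closedBall hz⟩).1.mul hquot

/-! ### Families with unimodular roots over the imaginary axis -/

theorem eq_zero_of_eq_zero_on_imaginary_axis {f : ℂ → ℂ} (hf : Differentiable ℂ f)
    (h : ∀ t : ℝ, f (t * Complex.I) = 0) (s : ℂ) : f s = 0 := by
  have hfa : AnalyticOnNhd ℂ f univ := fun z _ => hf.analyticAt z
  have htend : Tendsto (fun t : ℝ => (t : ℂ) * Complex.I) (𝓝[≠] 0) (𝓝[≠] 0) := by
    refine tendsto_nhdsWithin_of_tendsto_nhds_of_eventually_within _ ?_ ?_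
    · have : Continuous fun t : ℝ => (t : ℂ) * Complex.I := by fun_prop
      simpa using (this.tendsto 0).mono_left nhdsWithin_le_nhds
    · filter_upwards [self_mem_nhdsWithin] with t ht
      simpa using ht
  exact hfa.eqOn_zero_of_preconnected_of_frequently_eq_zero isPreconnected_univ
    (mem_univ 0) (htend.frequently (Eventually.of_forall h).frequently) (mem_univ s)

theorem norm_leadingCoeff_eq_of_roots_unit {q : ℂ[X]} (hq : ∀ a ∈ q.roots, ‖a‖ = 1) :
    ‖q.leadingCoeff‖ = ‖q.coeff 0‖ := by
  have h1 : ‖(q.roots.map (0 - ·)).prod‖ = 1 := by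
    refine Multiset.prod_induction (fun x : ℂ => ‖x‖ = 1) _ (fun a b ha hb => by simp [ha, hb])
      (by simp) fun x hx => ?_
    obtain ⟨a, ha, rfl⟩ := Multiset.mem_map.1 hx
    simpa using hq a ha
  rw [coeff_zero_eq_eval_zero, (IsAlgClosed.splits q).eval_eq_prod_roots, norm_mul, h1, mul_one]

/-- A bounded-degree entire family of polynomials with constant nonzero constant term, whose roots
are unimodular for imaginary parameters, has constant degree. The generic leading coefficient `c`
has constant modulus wherever it is nonzero on the imaginary axis, so the entire function
`c(s) * conj (c(-conj s))` takes at most the values `0` and `|c₀|²` there; hence it is constant, and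
it is not zero. -/
theorem exists_natDegree_eq {Q : ℂ → ℂ[X]} {N : ℕ} {c₀ : ℂ}
    (hcoeff : ∀ k, Differentiable ℂ fun s => (Q s).coeff k) (hdeg : ∀ s, (Q s).natDegree ≤ N)
    (hc₀ : c₀ ≠ 0) (hzero : ∀ s, (Q s).coeff 0 = c₀)
    (hroots : ∀ t : ℝ, ∀ a ∈ (Q (t * Complex.I)).roots, ‖a‖ = 1) :
    ∃ d, ∀ s, (Q s).natDegree = d := by
  classical
  set P : ℕ → Prop := fun k => ∃ s, (Q s).coeff k ≠ 0 with hP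
  set d := Nat.findGreatest P N with hd
  have hPd : P d := Nat.findGreatest_spec (m := 0) (Nat.zero_le N) ⟨0, by rwa [hzero]⟩
  -- `d` is the generic degree: higher coefficients vanish identically.
  have hle : ∀ s, (Q s).natDegree ≤ d := by
    intro s
    have hQs : Q s ≠ 0 := fun h => hc₀ (by rw [← hzero s, h, coeff_zero])
    exact Nat.le_findGreatest (hdeg s) ⟨s, leadingCoeff_ne_zero.2 hQs⟩
  set c : ℂ → ℂ := fun s => (Q s).coeff d with hc
  have hcd : Differentiable ℂ c := hcoeff d
  have hnorm : ∀ t : ℝ, c (t * Complex.I) ≠ 0 → ‖c (t * Complex.I)‖ = ‖c₀‖ := by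
    intro t ht
    have : (Q (t * Complex.I)).natDegree = d := le_antisymm (hle _) (le_natDegree_of_ne_zero ht)
    have h := norm_leadingCoeff_eq_of_roots_unit (hroots t)
    rwa [leadingCoeff, this, hzero] at h
  -- The reflection `s ↦ -conj s` fixes the imaginary axis, so `h` is `|c|²` there.
  set h : ℂ → ℂ := fun s => c s * (starRingEnd ℂ) (c ((starRingEnd ℂ) (-s))) with hh
  have hhd : Differentiable ℂ h := by
    refine hcd.mul fun s => ?_
    have h1 : DifferentiableAt ℂ (starRingEnd ℂ ∘ c ∘ starRingEnd ℂ) (-s) :=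
      differentiableAt_conj_conj_iff.2 (hcd _)
    exact h1.comp (f := fun s => -s) s (by fun_prop)
  have hI : ∀ t : ℝ, h (t * Complex.I) = ((‖c (t * Complex.I)‖ ^ 2 : ℝ) : ℂ) := by
    intro t
    have : (starRingEnd ℂ) (-((t : ℂ) * Complex.I)) = t * Complex.I := by simp
    simp only [hh, this]
    rw [Complex.mul_conj, Complex.normSq_eq_norm_sq]
  have hprod : ∀ s, h s * (h s - ((‖c₀‖ ^ 2 : ℝ) : ℂ)) = 0 := by
    refine eq_zero_of_eq_zero_on_imaginary_axis (hhd.mul (hhd.sub_const _)) fun t => ?_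
    rw [hI]
    by_cases ht : c (t * Complex.I) = 0
    · simp [ht]
    · rw [hnorm t ht, sub_self, mul_zero]
  have hcne : ∀ s, c s ≠ 0 := by
    rcases AnalyticOnNhd.eq_zero_or_eq_zero_of_mul_eq_zero (U := univ)
      (fun z _ => hhd.analyticAt z) (fun z _ => (hhd.sub_const _).analyticAt z)
      (fun z _ => hprod z) isPreconnected_univ with h0 | h0
    · obtain ⟨s, hs⟩ := hPd
      refine absurd (eq_zero_of_eq_zero_on_imaginary_axis hcd (fun t => ?_) s) hs
      have := h0 (t * Complex.I) (mem_univ _)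
      rw [hI] at this
      simpa using this
    · intro s hs
      have := h0 s (mem_univ s)
      simp [hh, hs, hc₀] at this
  exact ⟨d, fun s => le_antisymm (hle s) (le_natDegree_of_ne_zero (hcne s))⟩

/-! ### Restriction of a polynomial to complex lines through the origin -/

variable {n : ℕ}

/-- The polynomial `ζ ↦ p(ζ w)` in one variable: the restriction of `p` to the line through `0`
and `w`. -/
noncomputable def lineRestriction (p : MvPolynomial (Fin n) ℂ) (w : Fin n → ℂ) : ℂ[X] :=
  MvPolynomial.aeval (fun i => C (w i) * X) p

theorem eval_lineRestriction (p : MvPolynomial (Fin n) ℂ) (w : Fin n → ℂ) (ζ : ℂ) :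
    (lineRestriction p w).eval ζ = MvPolynomial.eval (fun i => w i * ζ) p := by
  unfold lineRestriction
  induction p using MvPolynomial.induction_on with
  | C a => simp
  | add p q hp hq => simp [hp, hq]
  | mul_X p i hp => simp [hp]

theorem coeff_zero_lineRestriction (p : MvPolynomial (Fin n) ℂ) (w : Fin n → ℂ) :
    (lineRestriction p w).coeff 0 = MvPolynomial.eval 0 p := by
  rw [coeff_zero_eq_eval_zero, eval_lineRestriction]
  congr 2
  ext i
  simp

theorem differentiable_coeff_lineRestriction (p : MvPolynomial (Fin n) ℂ) {γ : ℂ → Fin n → ℂ}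
    (hγ : ∀ i, Differentiable ℂ fun s => γ s i) (k : ℕ) :
    Differentiable ℂ fun s => (lineRestriction p (γ s)).coeff k := by
  unfold lineRestriction
  induction p using MvPolynomial.induction_on generalizing k with
  | C a => simp
  | add p q hp hq => simpa using (hp k).fun_add (hq k)
  | mul_X p i hp =>
    simp only [map_mul, MvPolynomial.aeval_X, ← mul_assoc]
    cases k with
    | zero => simp
    | succ k => simpa using (hp k).fun_mul (hγ i)

theorem exists_natDegree_lineRestriction_le (p : MvPolynomial (Fin n) ℂ) :
    ∃ N, ∀ w, (lineRestriction p w).natDegree ≤ N := by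
  unfold lineRestriction
  induction p using MvPolynomial.induction_on with
  | C a => exact ⟨0, fun w => by simp⟩
  | add p q hp hq =>
    obtain ⟨M, hM⟩ := hp
    obtain ⟨N, hN⟩ := hq
    exact ⟨max M N, fun w => by
      rw [map_add]; exact natDegree_add_le_of_degree_le
        ((hM w).trans (le_max_left _ _)) ((hN w).trans (le_max_right _ _))⟩
  | mul_X p i hp =>
    obtain ⟨M, hM⟩ := hp
    exact ⟨M + 1, fun w => by
      rw [map_mul, MvPolynomial.aeval_X]
      exact natDegree_mul_le_of_le (hM w) (natDegree_C_mul_le _ _ |>.trans natDegree_X_le)⟩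

/-! ### Functions on the zero set -/

theorem eval_zero_ne_zero {p : MvPolynomial (Fin n) ℂ}
    (hp : Disjoint (zeroSet p) (polydisk n ∪ exteriorPolydisk n)) :
    MvPolynomial.eval 0 p ≠ 0 :=
  fun h => disjoint_left.1 hp (show (0 : Fin n → ℂ) ∈ zeroSet p from h)
    (Or.inl fun i => by simp)

/-- A zero of `p` whose coordinates all have the same modulus lies on the torus. For `n = 0` the
modulus `ρ` is arbitrary, but then `p` has no zeros. -/
theorem norm_eq_one_of_mem_zeroSet {p : MvPolynomial (Fin n) ℂ}
    (hp : Disjoint (zeroSet p) (polydisk n ∪ exteriorPolydisk n)) {z : Fin n → ℂ} {ρ : ℝ}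
    (hz : z ∈ zeroSet p) (hρ : ∀ i, ‖z i‖ = ρ) : ρ = 1 := by
  rcases lt_trichotomy ρ 1 with h | h | h
  · exact absurd (Or.inl fun i => (hρ i).trans_lt h) (disjoint_left.1 hp hz)
  · exact h
  · exact absurd (Or.inr fun i => h.trans_eq (hρ i).symm) (disjoint_left.1 hp hz)

/-- A point with nonzero coordinates lies on an entire curve that maps the imaginary axis into the
torus: take the coordinates to be constant multiples of exponentials. -/
theorem exists_entire_curve {w : Fin n → ℂ} (hw : ∀ i, w i ≠ 0) :
    ∃ γ : ℂ → Fin n → ℂ, (∀ i, Differentiable ℂ fun s => γ s i) ∧ γ 1 = w ∧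
      ∀ t : ℝ, ∀ i, ‖γ (t * Complex.I) i‖ = 1 := by
  have hn : ∀ i, ‖w i‖ ≠ 0 := fun i => norm_ne_zero_iff.2 (hw i)
  refine ⟨fun s i => w i / ‖w i‖ * Complex.exp (s * Real.log ‖w i‖), fun i => by fun_prop,
    ?_, fun t i => ?_⟩
  · ext i
    have h : Complex.exp (1 * (Real.log ‖w i‖ : ℂ)) = ‖w i‖ := by
      rw [one_mul, ← Complex.ofReal_exp, Real.exp_log (norm_pos_iff.2 (hw i))]
    simp only [h]
    exact div_mul_cancel₀ _ (by exact_mod_cast hn i)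
  · rw [norm_mul, norm_div, Complex.norm_real, norm_norm, div_self (hn i), one_mul,
      Complex.norm_exp]
    simp

/-- Vanishing off the coordinate hyperplanes. Along an entire curve `γ` through `w` as in
`exists_entire_curve`, the trace over the roots `ζ` of `ζ ↦ p(ζ γ(s))` of `f(ζ γ(s))`, weighted by
a polynomial in `ζ`, is entire and vanishes on the imaginary axis, hence also at `s = 1`. The weight
is chosen so that only the term of `w` survives there. -/
theorem eq_zero_of_forall_ne_zero {p : MvPolynomial (Fin n) ℂ}
    (hp : Disjoint (zeroSet p) (polydisk n ∪ exteriorPolydisk n)) {f : zeroSet p → ℂ}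
    (hf : f ∈ Hol (zeroSet p)) (hf0 : ∀ z : zeroSet p, (z : Fin n → ℂ) ∈ torus n → f z = 0)
    (w : zeroSet p) (hw : ∀ i, (w : Fin n → ℂ) i ≠ 0) : f w = 0 := by
  classical
  obtain ⟨γ, hγ, hγ1, hγI⟩ := exists_entire_curve hw
  set Q : ℂ → ℂ[X] := fun s => lineRestriction p (γ s) with hQ
  have hQeval : ∀ s ζ, (Q s).eval ζ = 0 ↔ (fun i => γ s i * ζ) ∈ zeroSet p := fun s ζ => by
    rw [hQ, eval_lineRestriction]; rfl
  have hcoeff := differentiable_coeff_lineRestriction p hγ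
  have hroots : ∀ t : ℝ, ∀ a ∈ (Q (t * Complex.I)).roots, ‖a‖ = 1 := fun t a ha =>
    norm_eq_one_of_mem_zeroSet hp ((hQeval _ a).1 (isRoot_of_mem_roots ha))
      fun i => by rw [norm_mul, hγI, one_mul]
  have hp0 := eval_zero_ne_zero hp
  have hne : ∀ s, Q s ≠ 0 := fun s h => hp0 (by
    rw [← coeff_zero_lineRestriction p (γ s), show lineRestriction p (γ s) = 0 from h, coeff_zero])
  obtain ⟨N, hN⟩ := exists_natDegree_lineRestriction_le p
  obtain ⟨d, hd⟩ := exists_natDegree_eq (Q := Q) hcoeff (fun s => hN (γ s)) hp0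
    (fun s => coeff_zero_lineRestriction p (γ s)) hroots
  -- `L` separates the root `1` of `Q 1`, which corresponds to `w`, from its other roots.
  set L : ℂ[X] := ∏ a ∈ (Q 1).roots.toFinset.erase 1, (X - C a) with hL
  set F : (Fin n → ℂ) → ℂ := fun z => if h : z ∈ zeroSet p then f ⟨z, h⟩ else 0 with hF
  set G : ℂ → ℂ → ℂ := fun s ζ => F (fun i => γ s i * ζ) * L.eval ζ with hG
  have hdiff : Differentiable ℂ fun s => ((Q s).roots.map (G s)).sum := by
    intro s₀
    refine differentiableAt_sum_roots hcoeff hd hne fun ζ₀ hζ₀ => ?_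
    obtain ⟨U, hU, hmem, g, hg, hgf⟩ := hf ⟨_, (hQeval s₀ ζ₀).1 hζ₀⟩
    have hΓ : Differentiable ℂ fun x : ℂ × ℂ => fun i => γ x.1 i * x.2 :=
      differentiable_pi.2 fun i => ((hγ i).comp differentiable_fst).mul differentiable_snd
    refine ⟨fun x => g (fun i => γ x.1 i * x.2) * L.eval x.2, ?_⟩
    filter_upwards [hΓ.continuous.continuousAt.preimage_mem_nhds (hU.mem_nhds hmem)] with x hx
    refine ⟨?_, fun h0 => ?_⟩
    · have h1 : DifferentiableAt ℂ (fun x : ℂ × ℂ => g (fun i => γ x.1 i * x.2)) x :=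
        DifferentiableAt.comp (g := g) x (hg.differentiableAt (hU.mem_nhds hx)) (hΓ x)
      have h2 : DifferentiableAt ℂ (fun x : ℂ × ℂ => L.eval x.2) x :=
        DifferentiableAt.comp (g := fun z => L.eval z) x L.differentiable.differentiableAt
          differentiableAt_snd
      exact h1.mul h2
    · have hz := (hQeval x.1 x.2).1 h0
      simp only [hG, hF, dif_pos hz]
      rw [hgf ⟨_, hz⟩ hx]
  have hsum : ((Q 1).roots.map (G 1)).sum = 0 := by
    refine eq_zero_of_eq_zero_on_imaginary_axis hdiff (fun t => ?_) 1
    refine Multiset.sum_eq_zero fun x hx => ?_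
    obtain ⟨a, ha, rfl⟩ := Multiset.mem_map.1 hx
    have hz := (hQeval _ a).1 (isRoot_of_mem_roots ha)
    simp only [hG, hF, dif_pos hz]
    rw [hf0 ⟨_, hz⟩ fun i => by simp only [norm_mul, hγI, one_mul, hroots t a ha], zero_mul]
  have hw1 : (fun i => γ 1 i * 1) = (w : Fin n → ℂ) := by simp [hγ1]
  have h1 : (1 : ℂ) ∈ (Q 1).roots := by
    rw [mem_roots (hne 1), IsRoot.def, hQeval, hw1]
    exact w.2
  rw [Finset.sum_multiset_map_count, Finset.sum_eq_single_of_mem 1 (Multiset.mem_toFinset.2 h1),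
    nsmul_eq_mul] at hsum
  · have hL1 : L.eval 1 ≠ 0 := by
      rw [hL, eval_prod, Finset.prod_ne_zero_iff]
      intro a ha
      rw [eval_sub, eval_X, eval_C]
      exact sub_ne_zero.2 (Finset.ne_of_mem_erase ha).symm
    have hcount : ((Multiset.count 1 (Q 1).roots : ℕ) : ℂ) ≠ 0 := by
      exact_mod_cast (Multiset.count_pos.2 h1).ne'
    have := (mul_eq_zero.1 ((mul_eq_zero.1 hsum).resolve_left hcount)).resolve_right hL1
    rw [hw1] at this
    simpa [hF, w.2] using this
  · intro a ha ha1
    have : L.eval a = 0 := by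
      rw [hL, eval_prod]
      exact Finset.prod_eq_zero (Finset.mem_erase.2 ⟨ha1, ha⟩) (by simp)
    simp [hG, this]

/-- The zeros off the coordinate hyperplanes are dense in the zero set if `p(0) ≠ 0`. The function
`ζ ↦ p(ζ a)` has an isolated zero at `1`, and by the maximum principle a zero near `1` persists
when `a` is moved to a nearby point `w` with nonzero coordinates. -/
theorem mem_closure_zeroSet_ne_zero {p : MvPolynomial (Fin n) ℂ}
    (hp0 : MvPolynomial.eval 0 p ≠ 0) {a : Fin n → ℂ} (ha : a ∈ zeroSet p) :
    a ∈ closure {z | z ∈ zeroSet p ∧ ∀ i, z i ≠ 0} := by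
  rw [mem_closure_iff_nhds]
  intro V hV
  set E : (Fin n → ℂ) × ℂ → ℂ := fun x => MvPolynomial.eval (fun i => x.1 i * x.2) p with hE
  have hmul : Continuous fun x : (Fin n → ℂ) × ℂ => fun i => x.1 i * x.2 := by fun_prop
  have hEc : Continuous E := (MvPolynomial.continuous_eval p).comp hmul
  have hEline : ∀ w ζ, E (w, ζ) = (lineRestriction p w).eval ζ :=
    fun w ζ => (eval_lineRestriction p w ζ).symm
  have hEa : E (a, 1) = 0 := by
    simp only [hE, mul_one]
    exact ha
  have hqa : lineRestriction p a ≠ 0 := fun h => hp0 (by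
    rw [← coeff_zero_lineRestriction p a, h, coeff_zero])
  -- A circle about `1` on which `ζ ↦ p (ζ a)` does not vanish.
  obtain ⟨r, hr, hr1, hrV, hrne⟩ : ∃ r > 0, r < 1 ∧
      (∀ x ∈ ball a r ×ˢ closedBall (1 : ℂ) r, (fun i => x.1 i * x.2) ∈ V) ∧
      ∀ ζ ∈ sphere (1 : ℂ) r, E (a, ζ) ≠ 0 := by
    have h1 : ∀ᶠ x in 𝓝 (a, (1 : ℂ)), (fun i => x.1 i * x.2) ∈ V :=
      hmul.continuousAt.preimage_mem_nhds (by simpa using hV)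
    have h2 : ∀ᶠ ζ in 𝓝[≠] (1 : ℂ), E (a, ζ) ≠ 0 := by
      simp only [hEline]
      have hcl : IsClosed (((lineRestriction p a).roots.toFinset : Set ℂ) \ {1}) :=
        ((Finset.finite_toSet _).subset sdiff_subset).isClosed
      filter_upwards [mem_nhdsWithin_of_mem_nhds (hcl.isOpen_compl.mem_nhds
        fun h => h.2 rfl), self_mem_nhdsWithin] with ζ hζ hζ1 h0
      exact hζ ⟨by simpa [hqa] using h0, hζ1⟩
    obtain ⟨ε, hε, h1⟩ := Metric.eventually_nhds_iff_ball.1 h1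
    obtain ⟨η, hη, h2⟩ := Metric.eventually_nhds_iff_ball.1 (eventually_nhdsWithin_iff.1 h2)
    have hm : 0 < min 1 (min ε η) := lt_min one_pos (lt_min hε hη)
    have hε' : min 1 (min ε η) ≤ ε := (min_le_right _ _).trans (min_le_left _ _)
    have hη' : min 1 (min ε η) ≤ η := (min_le_right _ _).trans (min_le_right _ _)
    have h1' : min 1 (min ε η) ≤ 1 := min_le_left _ _
    refine ⟨min 1 (min ε η) / 2, half_pos hm, by linarith, fun x hx => h1 x ?_, fun ζ hζ =>
      h2 ζ ?_ fun h => ?_⟩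
    · rw [← ball_prod_same]
      exact ⟨ball_subset_ball (by linarith) hx.1, closedBall_subset_ball (by linarith) hx.2⟩
    · rw [mem_ball, mem_sphere.1 hζ]; linarith
    · rw [mem_singleton_iff.1 h, mem_sphere, dist_self] at hζ; linarith
  obtain ⟨ζm, hζm, hmin⟩ := (isCompact_sphere (1 : ℂ) r).exists_isMinOn
    (NormedSpace.sphere_nonempty.2 hr.le) (f := fun ζ => ‖E (a, ζ)‖)
    (by fun_prop)
  set m := ‖E (a, ζm)‖ with hm
  have hmpos : 0 < m := norm_pos_iff.2 (hrne ζm hζm)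
  have hev1 : ∀ᶠ w in 𝓝 a, ∀ ζ ∈ sphere (1 : ℂ) r, m / 2 < ‖E (w, ζ) - E (w, 1)‖ := by
    refine (isCompact_sphere (1 : ℂ) r).eventually_forall_of_forall_eventually fun ζ hζ => ?_
    have hc : Continuous fun x : (Fin n → ℂ) × ℂ => ‖E (x.1, x.2) - E (x.1, 1)‖ := by fun_prop
    refine hc.continuousAt.eventually_const_lt ?_
    have : m ≤ ‖E (a, ζ)‖ := hmin hζ
    simp only [hEa, sub_zero]
    linarith
  have hev2 : ∀ᶠ w in 𝓝 a, ‖E (w, 1)‖ < m / 2 / 2 := by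
    have hc : Continuous fun w : Fin n → ℂ => ‖E (w, 1)‖ := by fun_prop
    refine hc.continuousAt.eventually_lt_const ?_
    simp only [hEa, norm_zero]
    positivity
  have hdense : Dense {w : Fin n → ℂ | ∀ i, w i ≠ 0} := by
    have := dense_pi univ (s := fun _ : Fin n => ({0}ᶜ : Set ℂ)) fun i _ => dense_compl_singleton 0
    simpa [Set.pi] using this
  obtain ⟨w, ⟨⟨hw1, hw2⟩, hw3⟩, hw⟩ := mem_closure_iff_nhds.1 (hdense a) _
    ((hev1.and hev2).and (ball_mem_nhds a hr))
  obtain ⟨ζ, hζ, hζ0⟩ : ∃ ζ ∈ closedBall (1 : ℂ) r, E (w, ζ) = 0 := by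
    have hd : Differentiable ℂ fun ζ => E (w, ζ) := by
      simp only [hEline]; exact (lineRestriction p w).differentiable
    have h0 : (0 : ℂ) ∈ ball (E (w, 1)) (m / 2 / 2) := by
      rwa [mem_ball, dist_comm, dist_zero_right]
    refine hd.diffContOnCl.ball_subset_image_closedBall hr (fun ζ hζ => (hw1 ζ hζ).le) ?_ h0
    intro hcon
    simp only [not_not] at hcon
    have heq := AnalyticOnNhd.eq_of_eventuallyEq (fun z _ => hd.analyticAt z)
      (fun z _ => analyticAt_const) hcon
    have := hw1 ζm hζm
    rw [show E (w, ζm) = E (w, 1) from congrFun heq ζm, sub_self, norm_zero] at this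
    linarith
  refine ⟨fun i => w i * ζ, hrV (w, ζ) ⟨hw3, hζ⟩, hζ0, fun i => mul_ne_zero (hw i) fun h => ?_⟩
  rw [h, mem_closedBall, dist_zero_left, norm_one] at hζ
  linarith

theorem isToral_of_disjoint {p : MvPolynomial (Fin n) ℂ}
    (hp : Disjoint (zeroSet p) (polydisk n ∪ exteriorPolydisk n)) : IsToral p := by
  intro f hf hf0 a
  obtain ⟨U, hU, haU, g, hg, hgf⟩ := hf a
  rw [← hgf a haU]
  by_contra hne
  have hev : ∀ᶠ z in 𝓝 (a : Fin n → ℂ), g z ≠ 0 ∧ z ∈ U :=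
    ((hg.continuousOn.continuousAt (hU.mem_nhds haU)).eventually_ne hne).and (hU.mem_nhds haU)
  obtain ⟨z, ⟨hz, hzU⟩, hzp, hz0⟩ := mem_closure_iff_nhds.1
    (mem_closure_zeroSet_ne_zero (eval_zero_ne_zero hp) a.2) _ hev
  exact hz ((hgf ⟨z, hzp⟩ hzU).trans (eq_zero_of_forall_ne_zero hp hf hf0 ⟨z, hzp⟩ hz0))

end ToralSets

theorem theorem2p5 (n : ℕ) (p : MvPolynomial (Fin n) ℂ)
    (hp : Disjoint (ToralSets.zeroSet p)
      (ToralSets.polydisk n ∪ ToralSets.exteriorPolydisk n)) :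
    ToralSets.IsToral p := by
  exact ToralSets.isToral_of_disjoint hp
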